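/- Let $k\ge 1$, let $X$ and $Y_1,\dots,Y_k$ be real Hilbert spaces, let $g_i:Y_i\to\overline{\mathbb R}=\mathbb R\cup\{\pm\infty\}$ be proper, convex and lower semicontinuous, let $K_i:X\to Y_i$ be continuous linear operators with adjoints $K_i^*$, and let $\omega_i\in(0,1]$ $(i=1,\dots,k)$ with $\sum_{i=1}^k\omega_i=1$. Write $\operatorname{dom} g=\{y: g(y)<+\infty\}$, $g^*(u)=\sup_{y}\{\langle u,y\rangle-g(y)\}$ for the conjugate, $\partial$ for the convex subdifferential, and, for a convex set $C$, $\operatorname{sqri} C=\{c\in C:\bigcup_{\lambda>0}\lambda(C-c)\text{ is a closed linear subspace}\}$. For $\gamma>0$, $\operatorname{prox}_{\gamma f}(x)$ denotes the unique minimizer of $y\mapsto f(y)+\frac1{2\gamma}\|y-x\|^2$. Consider the primal problem $$(P)\quad \inf_{x\in X}\ \sum_{i=1}^k\omega_i\, g_i(K_ix)$$ and its Fenchel-type dual $$(D)\quad \sup\Big\{\sum_{i=1}^k-\omega_i\, g_i^*(y_i)\ :\ y_i\in Y_i,\ \sum_{i=1}^k\omega_iK_i^*y_i=0\Big\}.$$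 Assume that $(P)$ has an optimal solution $\hat x\in X$ and that at least one of the following conditions holds: 1. there is $x'\in\bigcap_{i=1}^kK_i^{-1}(\operatorname{dom} g_i)$ such that $g_i$ is continuous at $K_ix'$ for every $i=1,\dots,k$; 2. $0\in\operatorname{int}\big(\prod_{i=1}^k\operatorname{dom} g_i-\{(K_1x,\dots,K_kx):x\in X\}\big)$; 3. $0\in\operatorname{sqri}\big(\prod_{i=1}^k\operatorname{dom} g_i-\{(K_1x,\dots,K_kx):x\in X\}\big)$. Then: (i) There exists an optimal solution $(\hat y_1,\dots,\hat y_k)\in Y_1\times\dots\times Y_k$ of $(D)$, the optimal values of $(P)$ and $(D)$ coincide, and $$K_i\hat x\in\partial g_i^*(\hat y_i),\quad i=1,\dots,k,\qquad\text{and}\qquad \sum_{i=1}^k\omega_iK_i^*\hat y_i=0 .$$ (ii) Suppose that $X$ and $Y_1,\dots,Y_k$ are finite-dimensional. Let $\sigma,\tau>0$ satisfy $\sigma\tau\sum_{i=1}^k\|K_i\|^2<1$, let $(x^0,y_1^0,\dots,y_k^0)\in X\times Y_1\times\dots\times Y_k$ be arbitrary, put $\bar x^0:=x^0$, and for $n\ge0$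 set $$y_i^{n+1}:=\operatorname{prox}_{\sigma g_i^*}\big(y_i^n+\sigma K_i\bar x^n\big)\ (i=1,\dots,k),\qquad x^{n+1}:=x^n-\tau\sum_{i=1}^k\omega_iK_i^*y_i^{n+1},\qquad \bar x^{n+1}:=2x^{n+1}-x^n .$$ Then $(x^n)_{n\ge0}$ converges to an optimal solution of $(P)$ and $(y_1^n,\dots,y_k^n)_{n\ge0}$ converges to an optimal solution of $(D)$. -/

import Mathlib

open Filter Topology Set

noncomputable section

namespace PrimalDual

section Basic

variable {E : Type*}

/-- Effective domain of an extended-real-valued function. -/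
def dom (f : E → EReal) : Set E := {x | f x < ⊤}

/-- A function is proper if its domain is nonempty and it never takes the value `-∞`. -/
def IsProper (f : E → EReal) : Prop := (dom f).Nonempty ∧ ∀ x, ⊥ < f x

/-- Convexity of an extended-real-valued function: the epigraph is a convex set. -/
def IsConvex [AddCommGroup E] [Module ℝ E] (f : E → EReal) : Prop :=
  Convex ℝ {p : E × ℝ | f p.1 ≤ (p.2 : EReal)}

/-- Strong quasi-relative interior of a (convex) set: the points `x ∈ C` for which the cone
`⋃_{r > 0} r (C - x)` is a closed linear subspace. -/
def sqri [AddCommGroup E] [Module ℝ E] [TopologicalSpace E] (C : Set E) : Set E :=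
  {x | x ∈ C ∧ ∃ S : Submodule ℝ E, IsClosed (S : Set E) ∧
    {z : E | ∃ r : ℝ, 0 < r ∧ ∃ c ∈ C, z = r • (c - x)} = (S : Set E)}

variable [NormedAddCommGroup E] [InnerProductSpace ℝ E]

/-- Fenchel conjugate `f^*(u) = sup_x (⟨u, x⟩ - f x)`. -/
def conj (f : E → EReal) (u : E) : EReal := ⨆ x : E, ((inner ℝ u x : ℝ) : EReal) - f x

/-- Convex subdifferential, empty at points where `f` is not finite. -/
def subdiff (f : E → EReal) (x : E) : Set E :=
  {u | f x ≠ ⊤ ∧ f x ≠ ⊥ ∧ ∀ y : E, f x + ((inner ℝ u (y - x) : ℝ) : EReal) ≤ f y}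

/-- `p` is a minimizer of `y ↦ f y + (1 / (2γ)) ‖y - x‖²`. -/
def IsProxPoint (γ : ℝ) (f : E → EReal) (x p : E) : Prop :=
  IsMinOn (fun y : E => f y + ((1 / (2 * γ) * ‖y - x‖ ^ 2 : ℝ) : EReal)) univ p

/-- The proximal point of parameter `γ` of `f` at `x`. It is the minimizer described by
`IsProxPoint` (which exists and is unique for `γ > 0` and `f` proper, convex and lower
semicontinuous on a Hilbert space). -/
def prox (γ : ℝ) (f : E → EReal) (x : E) : E :=
  Classical.epsilon (IsProxPoint γ f x)

end Basic

section Problem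

variable {k : ℕ} {X : Type*} [NormedAddCommGroup X] [InnerProductSpace ℝ X] [CompleteSpace X]
  {Y : Fin k → Type*} [∀ i, NormedAddCommGroup (Y i)] [∀ i, InnerProductSpace ℝ (Y i)]
  [∀ i, CompleteSpace (Y i)]

/-- The primal objective `x ↦ ∑ ωᵢ gᵢ(Kᵢ x)`. -/
def primalObj (ω : Fin k → ℝ) (g : ∀ i, Y i → EReal) (K : ∀ i, X →L[ℝ] Y i) (x : X) : EReal :=
  ∑ i, (ω i : EReal) * g i (K i x)

/-- The dual objective `(y₁, …, y_k) ↦ ∑ -ωᵢ gᵢ^*(yᵢ)`. -/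
def dualObj (ω : Fin k → ℝ) (g : ∀ i, Y i → EReal) (y : ∀ i, Y i) : EReal :=
  ∑ i, -((ω i : EReal) * conj (g i) (y i))

/-- The dual feasible set `{y | ∑ ωᵢ Kᵢ^* yᵢ = 0}`. -/
def dualFeasible (ω : Fin k → ℝ) (K : ∀ i, X →L[ℝ] Y i) : Set (∀ i, Y i) :=
  {y | ∑ i, ω i • (ContinuousLinearMap.adjoint (K i)) (y i) = 0}

/-- `x` is an optimal solution of the primal problem. -/
def IsPrimalOptimal (ω : Fin k → ℝ) (g : ∀ i, Y i → EReal) (K : ∀ i, X →L[ℝ] Y i)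
    (x : X) : Prop :=
  IsMinOn (primalObj ω g K) univ x

/-- `y` is an optimal solution of the dual problem. -/
def IsDualOptimal (ω : Fin k → ℝ) (g : ∀ i, Y i → EReal) (K : ∀ i, X →L[ℝ] Y i)
    (y : ∀ i, Y i) : Prop :=
  y ∈ dualFeasible ω K ∧ IsMaxOn (dualObj ω g) (dualFeasible ω K) y

/-- Optimal value of the primal problem. -/
def primalValue (ω : Fin k → ℝ) (g : ∀ i, Y i → EReal) (K : ∀ i, X →L[ℝ] Y i) : EReal :=
  ⨅ x : X, primalObj ω g K x

/-- Optimal value of the dual problem. -/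
def dualValue (ω : Fin k → ℝ) (g : ∀ i, Y i → EReal) (K : ∀ i, X →L[ℝ] Y i) : EReal :=
  ⨆ y ∈ dualFeasible ω K, dualObj ω g y

/-- The set `∏ dom gᵢ - {(K₁ x, …, K_k x) : x ∈ X}` in the product space. -/
def diffSet (g : ∀ i, Y i → EReal) (K : ∀ i, X →L[ℝ] Y i) : Set (∀ i, Y i) :=
  {z | ∃ d ∈ univ.pi (fun i => dom (g i)), ∃ x : X, z = d - fun i => K i x}

/-- First qualification condition: the functions are continuous at a common domain point. -/
def QC1 (g : ∀ i, Y i → EReal) (K : ∀ i, X →L[ℝ] Y i) : Prop :=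
  ∃ x' : X, (∀ i, K i x' ∈ dom (g i)) ∧ ∀ i, ContinuousAt (g i) (K i x')

/-- Second qualification condition, through the interior. -/
def QC2 (g : ∀ i, Y i → EReal) (K : ∀ i, X →L[ℝ] Y i) : Prop :=
  (0 : ∀ i, Y i) ∈ interior (diffSet g K)

/-- Third qualification condition, through the strong quasi-relative interior. -/
def QC3 (g : ∀ i, Y i → EReal) (K : ∀ i, X →L[ℝ] Y i) : Prop :=
  (0 : ∀ i, Y i) ∈ sqri (diffSet g K)

/-- State `(xⁿ, x̄ⁿ, yⁿ)` of the primal-dual algorithm. -/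
structure State (X : Type*) {k : ℕ} (Y : Fin k → Type*) where
  x : X
  xbar : X
  y : ∀ i, Y i

/-- One iteration: first the dual variables, then `x`, then the extrapolated point `x̄`. -/
def step (ω : Fin k → ℝ) (g : ∀ i, Y i → EReal) (K : ∀ i, X →L[ℝ] Y i) (σ τ : ℝ)
    (s : State X Y) : State X Y :=
  let y' : ∀ i, Y i := fun i => prox σ (conj (g i)) (s.y i + σ • K i s.xbar)
  let x' : X := s.x - τ • ∑ i, ω i • (ContinuousLinearMap.adjoint (K i)) (y' i)
  { x := x', xbar := (2 : ℝ) • x' - s.x, y := y' }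

/-- The sequence generated by the algorithm from the starting point `(x⁰, y⁰)`, with `x̄⁰ = x⁰`. -/
def iter (ω : Fin k → ℝ) (g : ∀ i, Y i → EReal) (K : ∀ i, X →L[ℝ] Y i) (σ τ : ℝ)
    (x0 : X) (y0 : ∀ i, Y i) : ℕ → State X Y
  | 0 => { x := x0, xbar := x0, y := y0 }
  | n + 1 => step ω g K σ τ (iter ω g K σ τ x0 y0 n)

end Problem

end PrimalDual

end

/-! Duality comes from perturbing the arguments of the $g_i$. The value function
$v(z)=\inf_x\sum_i\omega_i g_i(K_ix+z_i)$ is convex, and a continuous subgradient of $v$ at $0$,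
with its $i$-th component divided by $\omega_i$, is a dual solution. Each qualification condition
implies the next, so only the sqri condition matters: it makes the domain of $v$ absorbing in a
closed subspace $S$. The closed convex relation $g_i(K_ix+z_i)\le r_i$ is then open at $0$
(`exists_section_mem_nhds`: Baire and a dyadic series), so $v$ is bounded above near $0$ in $S$.
Hahn–Banach (`exists_multiplier`) gives a subgradient on $S$, which extends to the whole product. It
vanishes on the range of $K$, which is dual feasibility, and testing one coordinate at a time gives
$y_i\in\partial g_i(K_i\hat x)$. Equality in Fenchel–Young then closes the duality gap.

For the algorithm, $u^n=(x^n,y^{n+1})$ is a proximal point iteration in the quadratic form $Q$ of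
`primalDualForm`, coercive because $\sigma\tau\sum\|K_i\|^2<1$. Monotonicity of $\partial g_i^*$
yields $Q(u^{n+1}-p)+Q(u^{n+1}-u^n)\le Q(u^n-p)$ for every solution $p$ (`primalDualForm_step_le`).
Hence $u^n$ is bounded, its increments vanish, its cluster points are solutions by closedness of the
graph, and Fejér monotonicity makes the whole sequence converge. Convexity and lower semicontinuity
of $g_i$ turn the limiting inclusions for $\partial g_i^*$ back into inclusions for $\partial g_i$.
-/

noncomputable section

namespace PrimalDual

/-! ### Openness of closed convex relations -/

section OpenMapping

open scoped Pointwise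

variable {E Z : Type*} [NormedAddCommGroup E] [NormedSpace ℝ E]
  [NormedAddCommGroup Z] [NormedSpace ℝ Z]

/-- Infinite convex combinations with dyadic weights: finite stage. -/
theorem dyadic_sum_mem {V : Type*} [AddCommGroup V] [Module ℝ V] {B : Set V} (hB : Convex ℝ B)
    {w : ℕ → V} (hw : ∀ n, w n ∈ B) (n : ℕ) {v : V} (hv : v ∈ B) :
    ∑ j ∈ Finset.range n, (1 / 2 : ℝ) ^ (j + 1) • w j + (1 / 2 : ℝ) ^ n • v ∈ B := by
  induction n generalizing v with
  | zero => simpa using hv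
  | succ n ih =>
    have h : (1 / 2 : ℝ) • w n + (1 / 2 : ℝ) • v ∈ B :=
      hB (hw n) hv (by norm_num) (by norm_num) (by norm_num)
    convert ih h using 1
    rw [Finset.sum_range_succ, pow_succ]
    module

/-- A bounded section of a closed convex set whose closure is a neighbourhood of zero is itself a
neighbourhood of zero. -/
theorem section_mem_nhds_of_closure_mem_nhds [CompleteSpace E] {C : Set (E × Z)}
    (hC : Convex ℝ C) (hcl : IsClosed C) {R : ℝ}
    (h : closure {z : Z | ∃ e, ‖e‖ ≤ R ∧ (e, z) ∈ C} ∈ 𝓝 0) :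
    {z : Z | ∃ e, ‖e‖ ≤ R ∧ (e, z) ∈ C} ∈ 𝓝 0 := by
  obtain ⟨ρ, hρ, hball⟩ := Metric.mem_nhds_iff.1 h
  -- Approximation to within $\rho/2$, so that the doubled error is again in the ball.
  have key : ∀ r : Metric.ball (0 : Z) ρ, ∃ w : E × Z,
      (‖w.1‖ ≤ R ∧ w ∈ C) ∧ (2 : ℝ) • (r.1 - w.2) ∈ Metric.ball (0 : Z) ρ := by
    intro r
    obtain ⟨u, ⟨e, he, heu⟩, hd⟩ := Metric.mem_closure_iff.1 (hball r.2) (ρ / 2) (by positivity)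
    refine ⟨(e, u), ⟨he, heu⟩, ?_⟩
    rw [mem_ball_zero_iff, norm_smul, ← dist_eq_norm]
    norm_num
    linarith
  choose w hw hres using key
  refine Filter.mem_of_superset (Metric.ball_mem_nhds 0 (half_pos hρ)) ?_
  intro z hz
  have hz2 : (2 : ℝ) • z ∈ Metric.ball (0 : Z) ρ := by
    rw [mem_ball_zero_iff] at hz ⊢
    rw [norm_smul]
    norm_num
    linarith
  -- Rescaled residuals. Starting from $2z$ makes the weights $2^{-(j+1)}$, which sum to one.
  let s : ℕ → Metric.ball (0 : Z) ρ :=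
    fun n => Nat.rec ⟨(2 : ℝ) • z, hz2⟩ (fun _ r => ⟨(2 : ℝ) • (r.1 - (w r).2), hres r⟩) n
  have hs : ∀ n, (s (n + 1)).1 = (2 : ℝ) • ((s n).1 - (w (s n)).2) := fun n => rfl
  have hsum : ∀ n, ∑ j ∈ Finset.range n, (1 / 2 : ℝ) ^ (j + 1) • (w (s j)).2
      = z - (1 / 2 : ℝ) ^ (n + 1) • (s n).1 := by
    intro n
    induction n with
    | zero => simp [s, smul_smul]
    | succ n ih =>
      rw [Finset.sum_range_succ, ih, hs, pow_succ _ (n + 1)]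
      module
  have hpow : Tendsto (fun n : ℕ => (1 / 2 : ℝ) ^ n) atTop (𝓝 0) :=
    tendsto_pow_atTop_nhds_zero_of_lt_one (by norm_num) (by norm_num)
  have hZ : Tendsto (fun n => ∑ j ∈ Finset.range n, (1 / 2 : ℝ) ^ (j + 1) • (w (s j)).2)
      atTop (𝓝 z) := by
    simp_rw [hsum]
    have : Tendsto (fun n => (1 / 2 : ℝ) ^ (n + 1) • (s n).1) atTop (𝓝 0) := by
      refine squeeze_zero_norm (a := fun n => (1 / 2 : ℝ) ^ (n + 1) * ρ) (fun n => ?_) ?_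
      · rw [norm_smul, Real.norm_of_nonneg (by positivity)]
        gcongr
        exact (mem_ball_zero_iff.1 (s n).2).le
      · simpa using (hpow.comp (tendsto_add_atTop_nat 1)).mul_const ρ
    simpa using tendsto_const_nhds.sub this
  have hgeo : HasSum (fun j : ℕ => R * (1 / 2 : ℝ) ^ (j + 1)) R := by
    have := (hasSum_geometric_two.mul_left (1 / 2 : ℝ)).mul_left R
    rw [show R * (1 / 2 * 2) = R by ring] at this
    simpa only [pow_succ'] using this
  have hle : ∀ j, ‖(1 / 2 : ℝ) ^ (j + 1) • (w (s j)).1‖ ≤ R * (1 / 2 : ℝ) ^ (j + 1) := by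
    intro j
    rw [norm_smul, Real.norm_of_nonneg (by positivity), mul_comm]
    gcongr
    exact (hw (s j)).1
  have hE := (Summable.of_norm_bounded hgeo.summable hle).hasSum.tendsto_sum_nat
  refine ⟨_, tsum_of_norm_bounded hgeo hle, ?_⟩
  -- The missing weight $2^{-n}$ is put on `w (s 0)`; its contribution vanishes in the limit.
  have hmem := fun n => dyadic_sum_mem hC (w := fun j => w (s j)) (fun j => (hw (s j)).2) n
    (hw (s 0)).2
  refine hcl.mem_of_tendsto (b := atTop) ?_ (Eventually.of_forall hmem)
  have h1 := (hE.prodMk_nhds hZ).add (hpow.smul_const (w (s 0)))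
  rw [zero_smul, add_zero] at h1
  refine h1.congr fun n => ?_
  congr 1
  ext <;> simp [Prod.fst_sum, Prod.snd_sum]

/-- Open mapping property of closed convex relations between Banach spaces: if the range of the
relation absorbs every point, a bounded section is a neighbourhood of zero. -/
theorem exists_section_mem_nhds [CompleteSpace E] [CompleteSpace Z] {C : Set (E × Z)}
    (hC : Convex ℝ C) (hcl : IsClosed C) {e₀ : E} (h₀ : (e₀, 0) ∈ C)
    (habs : ∀ z : Z, ∃ r : ℝ, 0 < r ∧ ∃ e c, (e, c) ∈ C ∧ z = r • c) :
    ∃ R : ℝ, {z : Z | ∃ e, ‖e‖ ≤ R ∧ (e, z) ∈ C} ∈ 𝓝 0 := by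
  refine ⟨‖e₀‖ + 1, section_mem_nhds_of_closure_mem_nhds hC hcl ?_⟩
  set U : Set Z := {z : Z | ∃ e, ‖e‖ ≤ ‖e₀‖ + 1 ∧ (e, z) ∈ C} with hU
  have hUc : Convex ℝ U := by
    rintro x ⟨e, he, hex⟩ y ⟨f, hf, hfy⟩ a b ha hb hab
    refine ⟨a • e + b • f, ?_, hC hex hfy ha hb hab⟩
    simpa using convex_closedBall (0 : E) (‖e₀‖ + 1) (by simpa using he : e ∈ _)
      (by simpa using hf) ha hb hab |> mem_closedBall_zero_iff.1
  have hU0 : (0 : Z) ∈ U := ⟨e₀, by linarith, h₀⟩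
  -- Moving from $(e_0,0)$ only a fraction $t$ of the way to $(e,c)$ scales the second component by
  -- $t$ and keeps the first within distance $1$ of $e_0$.
  have habsU : ∀ z : Z, ∃ n : ℕ, ∃ c ∈ U, z = ((n : ℝ) + 1) • c := by
    intro z
    obtain ⟨r, hr, e, c, hec, rfl⟩ := habs z
    obtain ⟨n, hn⟩ := exists_nat_ge (r * (‖e - e₀‖ + 1))
    have hn1 : 0 < (n : ℝ) + 1 := by positivity
    set t := r / ((n : ℝ) + 1) with ht
    have ht0 : 0 ≤ t := by positivity
    have htn : t * (‖e - e₀‖ + 1) ≤ 1 := by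
      rw [ht, div_mul_eq_mul_div, div_le_one hn1]; linarith
    have ht1 : t ≤ 1 := by nlinarith [norm_nonneg (e - e₀)]
    refine ⟨n, t • c, ⟨e₀ + t • (e - e₀), ?_, ?_⟩, ?_⟩
    · refine (norm_add_le _ _).trans ?_
      rw [norm_smul, Real.norm_of_nonneg ht0]
      nlinarith
    · convert hC h₀ hec (sub_nonneg.2 ht1) ht0 (by ring) using 1
      ext
      · simp; module
      · simp
    · rw [smul_smul, ht, mul_div_cancel₀ _ hn1.ne']
  obtain ⟨n, y, hy⟩ := nonempty_interior_of_iUnion_of_closed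
    (f := fun n : ℕ => ((n : ℝ) + 1) • closure U)
    (fun n => (isClosed_closure (s := U)).smul₀ _ )
    (eq_univ_of_forall fun z => by
      obtain ⟨n, c, hc, rfl⟩ := habsU z
      exact mem_iUnion.2 ⟨n, smul_mem_smul_set (subset_closure hc)⟩)
  have hn1 : 0 < (n : ℝ) + 1 := by positivity
  rw [interior_smul₀ hn1.ne'] at hy
  obtain ⟨v, hv, rfl⟩ := hy
  -- Since $-v=(m+1)c$, zero is the convex combination of the interior point $v$ and $c$ with
  -- weights $\frac1{m+2}$ and $\frac{m+1}{m+2}$.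
  obtain ⟨m, c, hc, hvc⟩ := habsU (-v)
  have hm1 : 0 < (m : ℝ) + 1 := by positivity
  rw [mem_interior_iff_mem_nhds.symm]
  have := hUc.closure.combo_interior_self_mem_interior hv (subset_closure hc)
    (a := 1 / ((m : ℝ) + 2)) (b := ((m : ℝ) + 1) / ((m : ℝ) + 2)) (by positivity) (by positivity)
    (by field_simp; ring)
  convert this using 1
  rw [div_eq_mul_inv ((m : ℝ) + 1), mul_comm, mul_smul, ← hvc]
  simp

end OpenMapping

/-! ### Nonvertical separation -/

/-- Existence of a Lagrange multiplier: a convex set of pairs, monotone and bounded above near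
zero, has a nonvertical supporting functional below. -/
theorem exists_multiplier {Z : Type*} [NormedAddCommGroup Z] [NormedSpace ℝ Z]
    {T : Set (Z × ℝ)} (hT : Convex ℝ T) {p M : ℝ} (hp : ∀ t, ((0 : Z), t) ∈ T → p ≤ t)
    (hM : ∀ᶠ z in 𝓝 (0 : Z), ∀ t, M ≤ t → (z, t) ∈ T) :
    ∃ l : Z →L[ℝ] ℝ, ∀ z t, (z, t) ∈ T → p + l z ≤ t := by
  have hinterior : ∀ t, M < t → ((0 : Z), t) ∈ interior T := by
    intro t ht
    rw [mem_interior_iff_mem_nhds, nhds_prod_eq]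
    filter_upwards [hM.prod_mk (Ioi_mem_nhds ht)] with q hq
    exact hq.1 q.2 (le_of_lt hq.2)
  have hnot : ((0 : Z), p) ∉ interior T := by
    intro h
    rw [mem_interior_iff_mem_nhds] at h
    have hc : Tendsto (fun t : ℝ => ((0 : Z), t)) (𝓝[<] p) (𝓝 ((0 : Z), p)) :=
      ((Continuous.prodMk_right (0 : Z)).tendsto p).mono_left nhdsWithin_le_nhds
    obtain ⟨t, ht, htp⟩ := ((hc.eventually h).and self_mem_nhdsWithin).exists
    exact absurd (hp t ht) (not_le.2 htp)
  obtain ⟨f, hf⟩ := geometric_hahn_banach_open_point hT.interior isOpen_interior hnot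
  have hle : ∀ q ∈ T, f q ≤ f (0, p) := by
    intro q hq
    have hq' : q ∈ closure (interior T) := by
      rw [hT.closure_interior_eq_closure_of_nonempty_interior
        ⟨_, hinterior (M + 1) (by linarith)⟩]
      exact subset_closure hq
    refine closure_minimal (fun a ha => (hf a ha).le) ?_ hq'
    exact isClosed_le f.continuous continuous_const
  have hdec : ∀ z t, f (z, t) = f (z, 0) + t * f (0, 1) := by
    intro z t
    have : ((z, t) : Z × ℝ) = (z, 0) + t • (0, 1) := by ext <;> simp
    rw [this, map_add, map_smul, smul_eq_mul]
  have hpM : p ≤ M := hp M (hM.self_of_nhds M le_rfl)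
  -- The hyperplane is not vertical: an interior point lies straight above $(0,p)$ and is strictly
  -- separated from it.
  have hneg : f (0, 1) < 0 := by
    have := hf _ (hinterior (M + 1) (by linarith))
    rw [hdec, hdec 0 p] at this
    nlinarith
  refine ⟨(-(f (0, 1))⁻¹) • f.comp (ContinuousLinearMap.inl ℝ Z ℝ), fun z t hzt => ?_⟩
  have h := hle _ hzt
  have h00 : f ((0 : Z), (0 : ℝ)) = 0 := f.map_zero
  rw [hdec, hdec 0 p, h00] at h
  simp only [smul_apply, ContinuousLinearMap.comp_apply,
    ContinuousLinearMap.inl_apply, smul_eq_mul]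
  set a := f (0, 1)
  have : (-a⁻¹) * f (z, 0) ≤ t - p := by
    have hia : 0 < -a⁻¹ := by simpa using hneg
    have h2 := mul_le_mul_of_nonneg_left (show f (z, 0) ≤ (t - p) * (-a) by linarith) hia.le
    have h3 : -a⁻¹ * ((t - p) * -a) = t - p := by
      have := hneg.ne
      field_simp
    linarith
  linarith

/-! ### Finite sums in `EReal` -/

section ExtendedReals

theorem coe_finset_sum {ι : Type*} (s : Finset ι) (f : ι → ℝ) :
    ((∑ i ∈ s, f i : ℝ) : EReal) = ∑ i ∈ s, (f i : EReal) := by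
  classical
  induction s using Finset.induction_on with
  | empty => simp
  | insert a s ha ih => rw [Finset.sum_insert ha, Finset.sum_insert ha, EReal.coe_add, ih]

theorem sum_ne_bot {ι : Type*} {s : Finset ι} {f : ι → EReal} (h : ∀ i ∈ s, f i ≠ ⊥) :
    ∑ i ∈ s, f i ≠ ⊥ := by
  classical
  induction s using Finset.induction_on with
  | empty => simp
  | insert a s ha ih =>
    rw [Finset.sum_insert ha, Ne, EReal.add_eq_bot_iff, not_or]
    exact ⟨h a (Finset.mem_insert_self a s), ih fun i hi => h i (Finset.mem_insert_of_mem hi)⟩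

/-- Since $\top+\bot=\bot$ in `EReal`, the value $\bot$ has to be excluded. -/
theorem sum_eq_top {ι : Type*} {s : Finset ι} {f : ι → EReal} (h : ∀ i ∈ s, f i ≠ ⊥) {i : ι}
    (hi : i ∈ s) (hf : f i = ⊤) : ∑ i ∈ s, f i = ⊤ := by
  classical
  rw [← Finset.add_sum_erase s f hi, hf, EReal.top_add_of_ne_bot]
  exact sum_ne_bot fun j hj => h j (Finset.mem_of_mem_erase hj)

theorem exists_eq_coe_of_ne {a : EReal} (h1 : a ≠ ⊤) (h2 : a ≠ ⊥) : ∃ r : ℝ, a = r :=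
  ⟨a.toReal, (EReal.coe_toReal h1 h2).symm⟩

end ExtendedReals

/-! ### Conjugates and subgradients -/

section Conjugate

variable {E : Type*}

theorem IsProper.exists_eq_coe {f : E → EReal} (hf : IsProper f) {x : E} (hx : x ∈ dom f) :
    ∃ r : ℝ, f x = r :=
  exists_eq_coe_of_ne (ne_of_lt hx) (hf.2 x).ne'

theorem isClosed_realEpigraph [TopologicalSpace E] {f : E → EReal} (hf : LowerSemicontinuous f) :
    IsClosed {p : E × ℝ | f p.1 ≤ (p.2 : EReal)} :=
  hf.isClosed_epigraph.preimage
    (continuous_fst.prodMk (continuous_coe_real_ereal.comp continuous_snd))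

variable [NormedAddCommGroup E] [InnerProductSpace ℝ E]

/-- Quantifying over points of the real epigraph keeps the arithmetic in $\mathbb R$; points with
$f(y)=\top$ impose nothing. -/
theorem mem_subdiff_iff {f : E → EReal} {x u : E} {r : ℝ} (hr : f x = r) :
    u ∈ subdiff f x ↔ ∀ (y : E) (t : ℝ), f y ≤ t → r + inner ℝ u (y - x) ≤ t := by
  constructor
  · intro h y t hyt
    have := (h.2.2 y).trans hyt
    rw [hr] at this
    exact_mod_cast this
  · intro h
    refine ⟨by simp [hr], by simp [hr], fun y => ?_⟩
    refine EReal.le_of_forall_lt_iff_le.1 fun t ht => ?_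
    rw [hr]
    exact_mod_cast h y t ht.le

/-- Fenchel–Young inequality. -/
theorem inner_sub_le_conj {f : E → EReal} {x : E} {t : ℝ} (h : f x ≤ t) (u : E) :
    ((inner ℝ u x - t : ℝ) : EReal) ≤ conj f u := by
  refine le_trans ?_ (le_iSup (fun x : E => ((inner ℝ u x : ℝ) : EReal) - f x) x)
  rw [EReal.coe_sub]
  exact EReal.sub_le_sub le_rfl h

theorem conj_le_iff {f : E → EReal} (hf : ∀ x, ⊥ < f x) {u : E} {r : ℝ} :
    conj f u ≤ r ↔ ∀ (x : E) (t : ℝ), f x ≤ t → inner ℝ u x - t ≤ r := by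
  constructor
  · intro h x t hxt
    exact_mod_cast (inner_sub_le_conj hxt u).trans h
  · intro h
    refine iSup_le fun x => ?_
    by_cases hx : f x = ⊤
    · simp [hx]
    · obtain ⟨s, hs⟩ := exists_eq_coe_of_ne hx (hf x).ne'
      rw [hs]
      exact_mod_cast h x s hs.le

theorem bot_lt_conj {f : E → EReal} (hf : IsProper f) (u : E) : ⊥ < conj f u := by
  obtain ⟨x, hx⟩ := hf.1
  obtain ⟨r, hr⟩ := hf.exists_eq_coe hx
  exact (EReal.bot_lt_coe _).trans_le (inner_sub_le_conj hr.le u)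

theorem conj_eq_of_mem_subdiff {f : E → EReal} (hf : IsProper f) {x u : E} {r : ℝ}
    (hr : f x = r) (hu : u ∈ subdiff f x) : conj f u = ((inner ℝ u x - r : ℝ) : EReal) := by
  refine le_antisymm ((conj_le_iff hf.2).2 fun y t hyt => ?_) (inner_sub_le_conj hr.le u)
  have := (mem_subdiff_iff hr).1 hu y t hyt
  rw [inner_sub_right] at this
  linarith

/-- Equality in Fenchel–Young at $(x,u)$ also makes $x$ a subgradient of the conjugate. This
direction needs only properness. -/
theorem mem_subdiff_conj_of_mem_subdiff {f : E → EReal} (hf : IsProper f) {x u : E}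
    (hu : u ∈ subdiff f x) : x ∈ subdiff (conj f) u := by
  obtain ⟨r, hr⟩ := exists_eq_coe_of_ne hu.1 hu.2.1
  refine (mem_subdiff_iff (conj_eq_of_mem_subdiff hf hr hu)).2 fun v t hvt => ?_
  have := (conj_le_iff hf.2).1 hvt x r hr.le
  rw [inner_sub_right, real_inner_comm v x, real_inner_comm u x]
  linarith

end Conjugate

/-! ### Weak duality and optimality certificates -/

section Duality

variable {k : ℕ} {X : Type*} [NormedAddCommGroup X] [InnerProductSpace ℝ X]
  {Y : Fin k → Type*} [∀ i, NormedAddCommGroup (Y i)] [∀ i, InnerProductSpace ℝ (Y i)]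
  {ω : Fin k → ℝ} {g : ∀ i, Y i → EReal} {K : ∀ i, X →L[ℝ] Y i}

theorem primalObj_le (hω : ∀ i, 0 < ω i) {x : X} {r : Fin k → ℝ}
    (h : ∀ i, g i (K i x) ≤ r i) : primalObj ω g K x ≤ ((∑ i, ω i * r i : ℝ) : EReal) := by
  rw [coe_finset_sum]
  refine Finset.sum_le_sum fun i _ => ?_
  rw [EReal.coe_mul]
  exact mul_le_mul_of_nonneg_left (h i) (by exact_mod_cast (hω i).le)

theorem primalObj_eq {x : X} {r : Fin k → ℝ} (h : ∀ i, g i (K i x) = r i) :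
    primalObj ω g K x = ((∑ i, ω i * r i : ℝ) : EReal) := by
  rw [coe_finset_sum]
  exact Finset.sum_congr rfl fun i _ => by rw [h, EReal.coe_mul]

theorem primalObj_eq_top (hω : ∀ i, 0 < ω i) (hg : ∀ i, IsProper (g i)) {x : X} {i : Fin k}
    (h : g i (K i x) = ⊤) : primalObj ω g K x = ⊤ := by
  refine sum_eq_top (fun j _ => ?_) (Finset.mem_univ i) ?_
  · by_cases hj : g j (K j x) = ⊤
    · rw [hj, EReal.coe_mul_top_of_pos (hω j)]
      exact top_ne_bot
    · obtain ⟨r, hr⟩ := exists_eq_coe_of_ne hj ((hg j).2 _).ne'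
      rw [hr, ← EReal.coe_mul]
      exact EReal.coe_ne_bot _
  · rw [h, EReal.coe_mul_top_of_pos (hω i)]

/-- A feasible point makes the optimal value less than $\top$; with positive weights no single term
can then be $\top$. -/
theorem exists_eq_coe_of_isPrimalOptimal (hω : ∀ i, 0 < ω i) (hg : ∀ i, IsProper (g i)) {x x' : X}
    (hx : IsPrimalOptimal ω g K x) (hx' : ∀ i, K i x' ∈ dom (g i)) :
    ∃ r : Fin k → ℝ, ∀ i, g i (K i x) = r i := by
  choose s hs using fun i => (hg i).exists_eq_coe (hx' i)
  have hle : primalObj ω g K x ≤ ((∑ i, ω i * s i : ℝ) : EReal) :=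
    (hx (mem_univ x')).trans (primalObj_eq hs).le
  have : ∀ i, ∃ r : ℝ, g i (K i x) = r := fun i =>
    exists_eq_coe_of_ne
      (fun h => absurd ((primalObj_eq_top hω hg h).symm.le.trans hle) (by simp)) ((hg i).2 _).ne'
  choose r hr using this
  exact ⟨r, hr⟩

variable [CompleteSpace X] [∀ i, CompleteSpace (Y i)]

theorem inner_sum_adjoint (y : ∀ i, Y i) (v : X) :
    inner ℝ (∑ i, ω i • (ContinuousLinearMap.adjoint (K i)) (y i)) v =
      ∑ i, ω i * inner ℝ (y i) (K i v) := by
  simp [sum_inner, real_inner_smul_left, ContinuousLinearMap.adjoint_inner_left]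

theorem sum_inner_eq_zero {y : ∀ i, Y i} (hy : y ∈ dualFeasible ω K) (x : X) :
    ∑ i, ω i * inner ℝ (y i) (K i x) = 0 := by
  rw [← inner_sum_adjoint, show ∑ i, ω i • (ContinuousLinearMap.adjoint (K i)) (y i) = 0 from hy,
    inner_zero_left]

/-- Weak duality. -/
theorem dualObj_le_primalObj (hω : ∀ i, 0 < ω i) (hg : ∀ i, IsProper (g i)) {y : ∀ i, Y i}
    (hy : y ∈ dualFeasible ω K) (x : X) : dualObj ω g y ≤ primalObj ω g K x := by
  by_cases htop : ∃ i, g i (K i x) = ⊤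
  · obtain ⟨i, hi⟩ := htop
    rw [primalObj_eq_top hω hg hi]
    exact le_top
  push Not at htop
  choose r hr using fun i => exists_eq_coe_of_ne (htop i) ((hg i).2 _).ne'
  have hterm : ∀ i, -((ω i : EReal) * conj (g i) (y i)) ≤
      ((ω i * r i - ω i * inner ℝ (y i) (K i x) : ℝ) : EReal) := by
    intro i
    rw [EReal.neg_le]
    refine le_trans (le_of_eq ?_) (mul_le_mul_of_nonneg_left (inner_sub_le_conj (hr i).le (y i))
      (by exact_mod_cast (hω i).le))
    rw [← EReal.coe_mul, ← EReal.coe_neg]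
    congr 1
    ring
  refine (Finset.sum_le_sum fun i _ => hterm i).trans ?_
  rw [← coe_finset_sum, primalObj_eq hr, Finset.sum_sub_distrib, sum_inner_eq_zero hy, sub_zero]

/-- Kuhn–Tucker pairs: `x` and `y` certify that both are optimal. -/
structure IsKuhnTucker (ω : Fin k → ℝ) (g : ∀ i, Y i → EReal) (K : ∀ i, X →L[ℝ] Y i)
    (x : X) (y : ∀ i, Y i) : Prop where
  mem_subdiff : ∀ i, y i ∈ subdiff (g i) (K i x)
  feasible : y ∈ dualFeasible ω K

/-- Fenchel–Young holds with equality in each term, and feasibility cancels the weighted inner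
products. -/
theorem IsKuhnTucker.dualObj_eq (hg : ∀ i, IsProper (g i)) {x : X} {y : ∀ i, Y i}
    (h : IsKuhnTucker ω g K x y) : dualObj ω g y = primalObj ω g K x := by
  choose r hr using fun i => exists_eq_coe_of_ne (h.mem_subdiff i).1 (h.mem_subdiff i).2.1
  have hterm : ∀ i, -((ω i : EReal) * conj (g i) (y i)) =
      ((ω i * r i - ω i * inner ℝ (y i) (K i x) : ℝ) : EReal) := by
    intro i
    rw [conj_eq_of_mem_subdiff (hg i) (hr i) (h.mem_subdiff i), ← EReal.coe_mul, ← EReal.coe_neg]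
    congr 1
    ring
  rw [dualObj, Finset.sum_congr rfl fun i _ => hterm i, ← coe_finset_sum, primalObj_eq hr,
    Finset.sum_sub_distrib, sum_inner_eq_zero h.feasible, sub_zero]

theorem IsKuhnTucker.isPrimalOptimal (hω : ∀ i, 0 < ω i) (hg : ∀ i, IsProper (g i)) {x : X}
    {y : ∀ i, Y i} (h : IsKuhnTucker ω g K x y) : IsPrimalOptimal ω g K x := fun x' _ =>
  (h.dualObj_eq hg).symm.le.trans (dualObj_le_primalObj hω hg h.feasible x')

theorem IsKuhnTucker.isDualOptimal (hω : ∀ i, 0 < ω i) (hg : ∀ i, IsProper (g i)) {x : X}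
    {y : ∀ i, Y i} (h : IsKuhnTucker ω g K x y) : IsDualOptimal ω g K y :=
  ⟨h.feasible, fun _ hy' => (dualObj_le_primalObj hω hg hy' x).trans (h.dualObj_eq hg).symm.le⟩

theorem IsKuhnTucker.primalValue_eq (hω : ∀ i, 0 < ω i) (hg : ∀ i, IsProper (g i)) {x : X}
    {y : ∀ i, Y i} (h : IsKuhnTucker ω g K x y) : primalValue ω g K = dualValue ω g K := by
  refine le_antisymm ?_ (iSup₂_le fun y' hy' => le_iInf fun x' => dualObj_le_primalObj hω hg hy' x')
  exact (iInf_le _ x).trans ((h.dualObj_eq hg).symm.le.trans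
    (le_iSup₂ (f := fun y (_ : y ∈ dualFeasible ω K) => dualObj ω g y) y h.feasible))

end Duality

/-! ### From the qualification conditions to a dual certificate -/

section Qualification

variable {k : ℕ} {X : Type*} [NormedAddCommGroup X] [InnerProductSpace ℝ X]
  {Y : Fin k → Type*} [∀ i, NormedAddCommGroup (Y i)] [∀ i, InnerProductSpace ℝ (Y i)]
  {ω : Fin k → ℝ} {g : ∀ i, Y i → EReal} {K : ∀ i, X →L[ℝ] Y i}

/-- With $x'$ fixed, continuity keeps $z_i+K_ix'$ in the domain for all small $z$. -/
theorem QC1.qc2 (h : QC1 g K) : QC2 g K := by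
  obtain ⟨x', hdom, hcont⟩ := h
  rw [QC2, mem_interior_iff_mem_nhds]
  have h1 : ∀ i, ∀ᶠ z : ∀ j, Y j in 𝓝 0, g i (z i + K i x') < ⊤ := by
    intro i
    have hc : Tendsto (fun z : ∀ j, Y j => z i + K i x') (𝓝 0) (𝓝 (K i x')) := by
      have : Continuous fun z : ∀ j, Y j => z i + K i x' := by fun_prop
      simpa using this.tendsto 0
    exact hc.eventually ((hcont i).eventually (Iio_mem_nhds (hdom i)))
  filter_upwards [eventually_all.2 h1] with z hz
  exact ⟨fun i => z i + K i x', fun i _ => hz i, x', by ext i; simp⟩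

/-- A neighbourhood of zero is absorbing, so the generated cone is the whole space. -/
theorem QC2.qc3 (h : QC2 g K) : QC3 g K := by
  refine ⟨interior_subset h, ⊤, isClosed_univ, ?_⟩
  rw [Submodule.top_coe, eq_univ_iff_forall]
  intro z
  have hc : Tendsto (fun t : ℝ => t • z) (𝓝[>] 0) (𝓝 0) := by
    have : Continuous fun t : ℝ => t • z := by fun_prop
    simpa using (this.tendsto 0).mono_left nhdsWithin_le_nhds
  obtain ⟨t, ht, ht0⟩ :=
    ((hc.eventually (mem_interior_iff_mem_nhds.1 h)).and self_mem_nhdsWithin).exists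
  have ht0 : 0 < t := ht0
  exact ⟨t⁻¹, inv_pos.2 ht0, t • z, ht, by rw [sub_zero, inv_smul_smul₀ ht0.ne']⟩

theorem QC3.exists_feasible (h : QC3 g K) : ∃ x, ∀ i, K i x ∈ dom (g i) := by
  obtain ⟨d, hd, x, hx⟩ := h.1
  refine ⟨x, fun i => ?_⟩
  have : K i x = d i := (sub_eq_zero.1 (congrFun hx i).symm).symm
  rw [this]
  exact hd i (mem_univ i)

/-- Under the qualification condition the value function of the perturbed problem has a
continuous subgradient at zero. -/
theorem QC3.exists_functional [CompleteSpace X] [∀ i, CompleteSpace (Y i)]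
    (hω : ∀ i, 0 < ω i) (hωsum : ∑ i, ω i = 1)
    (hg : ∀ i, IsProper (g i)) (hconv : ∀ i, IsConvex (g i))
    (hlsc : ∀ i, LowerSemicontinuous (g i)) (h : QC3 g K) {p : ℝ}
    (hp : ∀ x, (p : EReal) ≤ primalObj ω g K x) :
    ∃ l : (∀ i, Y i) →L[ℝ] ℝ, ∀ (x : X) (z : ∀ i, Y i) (r : Fin k → ℝ),
      (∀ i, g i (K i x + z i) ≤ r i) → p + l z ≤ ∑ i, ω i * r i := by
  obtain ⟨x₀, hx₀⟩ := h.exists_feasible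
  choose s₀ hs₀ using fun i => (hg i).exists_eq_coe (hx₀ i)
  obtain ⟨-, S, hScl, hS⟩ := h
  have : CompleteSpace S := hScl.completeSpace_coe
  have hmem : ∀ (x : X) (z : ∀ i, Y i) (r : Fin k → ℝ), (∀ i, g i (K i x + z i) ≤ r i) →
      z ∈ S := by
    intro x z r hz
    rw [← SetLike.mem_coe, ← hS]
    exact ⟨1, one_pos, z, ⟨fun i => K i x + z i,
      fun i _ => (hz i).trans_lt (EReal.coe_lt_top _), x, by ext i; simp⟩, by simp⟩
  -- The bounds $r_i$ belong to the source variable, so a norm bound on it also bounds the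
  -- objective.
  let C : Set ((X × (Fin k → ℝ)) × S) :=
    {q | ∀ i, g i (K i q.1.1 + (q.2 : ∀ i, Y i) i) ≤ q.1.2 i}
  have hCc : Convex ℝ C := by
    intro q hq q' hq' a b ha hb hab i
    have := hconv i (x := (K i q.1.1 + (q.2 : ∀ i, Y i) i, q.1.2 i)) (hq i)
      (y := (K i q'.1.1 + (q'.2 : ∀ i, Y i) i, q'.1.2 i)) (hq' i) ha hb hab
    have e : K i (a • q + b • q').1.1 + ((a • q + b • q').2 : ∀ i, Y i) i =
        a • (K i q.1.1 + (q.2 : ∀ i, Y i) i) + b • (K i q'.1.1 + (q'.2 : ∀ i, Y i) i) := by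
      simp
      abel
    rw [e]
    exact this
  have hCcl : IsClosed C := by
    have : C = ⋂ i, (fun q : (X × (Fin k → ℝ)) × S =>
        (K i q.1.1 + (q.2 : ∀ i, Y i) i, q.1.2 i)) ⁻¹' {p : Y i × ℝ | g i p.1 ≤ (p.2 : EReal)} := by
      ext q
      simp [C]
    rw [this]
    exact isClosed_iInter fun i => (isClosed_realEpigraph (hlsc i)).preimage
      ((((K i).continuous.comp (continuous_fst.comp continuous_fst)).add
        ((continuous_apply i).comp (continuous_subtype_val.comp continuous_snd))).prodMk
        ((continuous_apply i).comp (continuous_snd.comp continuous_fst)))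
  have habs : ∀ z : S, ∃ r : ℝ, 0 < r ∧ ∃ e c, (e, c) ∈ C ∧ z = r • c := by
    intro z
    have hz : (z : ∀ i, Y i) ∈ (S : Set (∀ i, Y i)) := z.2
    rw [← hS] at hz
    obtain ⟨r, hr, c, ⟨d, hd, x, rfl⟩, hzc⟩ := hz
    choose s hs using fun i => (hg i).exists_eq_coe (hd i (mem_univ i))
    have hle : ∀ i, g i (K i x + (d - fun i => K i x) i) ≤ s i := fun i => by
      simpa using (hs i).le
    exact ⟨r, hr, (x, s), ⟨_, hmem x _ s hle⟩, hle, Subtype.ext (by simpa using hzc)⟩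
  obtain ⟨R, hR⟩ := exists_section_mem_nhds hCc hCcl (e₀ := (x₀, s₀))
    (fun i => by simpa using (hs₀ i).le) habs
  let T : Set (S × ℝ) := {q | ∃ (x : X) (r : Fin k → ℝ),
    (∀ i, g i (K i x + (q.1 : ∀ i, Y i) i) ≤ r i) ∧ ∑ i, ω i * r i ≤ q.2}
  have hT : Convex ℝ T := by
    rintro q ⟨x, r, hr, hq⟩ q' ⟨x', r', hr', hq'⟩ a b ha hb hab
    refine ⟨a • x + b • x', a • r + b • r', ?_, ?_⟩
    · exact hCc (x := ((x, r), q.1)) hr (y := ((x', r'), q'.1)) hr' ha hb hab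
    · have e : ∑ i, ω i * (a • r + b • r') i
          = a * ∑ i, ω i * r i + b * ∑ i, ω i * r' i := by
        rw [Finset.mul_sum, Finset.mul_sum, ← Finset.sum_add_distrib]
        exact Finset.sum_congr rfl fun i _ => by simp; ring
      rw [e]
      exact add_le_add (mul_le_mul_of_nonneg_left hq ha) (mul_le_mul_of_nonneg_left hq' hb)
  -- $R$ serves as upper bound: $r_i\le\|r\|\le R$ in the sup norm, and the weights sum to one.
  obtain ⟨l, hl⟩ := exists_multiplier hT (p := p) (M := R)
    (by
      rintro t ⟨x, r, hr, hrt⟩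
      refine le_trans ?_ hrt
      exact_mod_cast (hp x).trans (primalObj_le hω fun i => by simpa using hr i))
    (by
      filter_upwards [hR] with z hz t ht
      obtain ⟨⟨x, r⟩, hxr, hz⟩ := hz
      refine ⟨x, r, hz, le_trans ?_ ht⟩
      calc ∑ i, ω i * r i ≤ ∑ i, ω i * R := by
            refine Finset.sum_le_sum fun i _ => mul_le_mul_of_nonneg_left ?_ (hω i).le
            exact (le_abs_self _).trans ((norm_le_pi_norm r i).trans
              ((norm_snd_le (x, r)).trans hxr))
        _ = R := by rw [← Finset.sum_mul, hωsum, one_mul])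
  obtain ⟨l', hl', -⟩ := exists_extension_norm_eq S l
  refine ⟨l', fun x z r hz => ?_⟩
  have := hl ⟨z, hmem x z r hz⟩ (∑ i, ω i * r i) ⟨x, r, hz, le_rfl⟩
  rwa [← hl'] at this

/-- Existence of a dual certificate for a primal solution. -/
theorem QC3.exists_isKuhnTucker [CompleteSpace X] [∀ i, CompleteSpace (Y i)]
    (hω : ∀ i, 0 < ω i) (hωsum : ∑ i, ω i = 1)
    (hg : ∀ i, IsProper (g i)) (hconv : ∀ i, IsConvex (g i))
    (hlsc : ∀ i, LowerSemicontinuous (g i)) (h : QC3 g K) {x : X}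
    (hx : IsPrimalOptimal ω g K x) : ∃ y, IsKuhnTucker ω g K x y := by
  obtain ⟨x₀, hx₀⟩ := h.exists_feasible
  obtain ⟨r, hr⟩ := exists_eq_coe_of_isPrimalOptimal hω hg hx hx₀
  obtain ⟨l, hl⟩ := h.exists_functional hω hωsum hg hconv hlsc (p := ∑ i, ω i * r i)
    fun x' => (primalObj_eq hr).symm.le.trans (hx (mem_univ x'))
  -- Replacing $x$ by $x-v$ and perturbing by $Kv$ leaves every argument unchanged; $v$ and $-v$
  -- give both signs.
  have hvanish : ∀ v : X, l (fun i => K i v) = 0 := by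
    have hle : ∀ v : X, l (fun i => K i v) ≤ 0 := by
      intro v
      have := hl (x - v) (fun i => K i v) r fun i => by
        rw [map_sub, sub_add_cancel]
        exact (hr i).le
      linarith
    intro v
    have h2 := hle (-v)
    have e : (fun i => K i (-v)) = -(fun i => K i v) := by
      ext i
      simp
    rw [e, map_neg] at h2
    exact le_antisymm (hle v) (by linarith)
  let y : ∀ i, Y i := fun i => (ω i)⁻¹ • (InnerProductSpace.toDual ℝ (Y i)).symm
    (l.comp (ContinuousLinearMap.single ℝ Y i))
  have hy : ∀ i d, l (Pi.single i d) = ω i * inner ℝ (y i) d := by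
    intro i d
    simp only [y]
    rw [real_inner_smul_left, InnerProductSpace.toDual_symm_apply,
      mul_inv_cancel_left₀ (hω i).ne']
    rfl
  refine ⟨y, fun i => ?_, ?_⟩
  · refine (mem_subdiff_iff (hr i)).2 fun w t hwt => ?_
    -- Only the $i$-th argument is moved, from $K_ix$ to $w$.
    have := hl x (Pi.single i (w - K i x)) (r + Pi.single i (t - r i)) fun j => by
      by_cases hj : j = i
      · subst hj
        simpa using hwt
      · simpa [hj] using (hr j).le
    rw [hy] at this
    have e : ∑ j, ω j * (r + Pi.single i (t - r i) : Fin k → ℝ) j =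
        ∑ j, ω j * r j + ω i * (t - r i) := by
      simp [mul_add, Finset.sum_add_distrib, Pi.single_apply]
    rw [e] at this
    have h3 : ω i * inner ℝ (y i) (w - K i x) ≤ ω i * (t - r i) := by linarith
    have := le_of_mul_le_mul_left h3 (hω i)
    linarith
  · refine ext_inner_right ℝ fun v => ?_
    rw [inner_zero_left, ← hvanish v, ← Finset.univ_sum_single (fun i => K i v), map_sum,
      sum_inner]
    refine Finset.sum_congr rfl fun i _ => ?_
    rw [hy, real_inner_smul_left, ContinuousLinearMap.adjoint_inner_left]

end Qualification

/-! ### Monotonicity, closed graph and inversion -/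

section Subdifferential

variable {E : Type*} [NormedAddCommGroup E] [InnerProductSpace ℝ E]

theorem inner_sub_nonneg_of_mem_subdiff {f : E → EReal} {x y u v : E} (hu : u ∈ subdiff f x)
    (hv : v ∈ subdiff f y) : 0 ≤ inner ℝ (u - v) (x - y) := by
  obtain ⟨r, hr⟩ := exists_eq_coe_of_ne hu.1 hu.2.1
  obtain ⟨s, hs⟩ := exists_eq_coe_of_ne hv.1 hv.2.1
  have h1 := (mem_subdiff_iff hr).1 hu y s hs.le
  have h2 := (mem_subdiff_iff hs).1 hv x r hr.le
  rw [← neg_sub x y, inner_neg_right] at h1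
  rw [inner_sub_left]
  linarith

/-- The subdifferential of a proper lower semicontinuous function has closed graph. -/
theorem mem_subdiff_of_tendsto {f : E → EReal} (hf : IsProper f) (hlsc : LowerSemicontinuous f)
    {p q : ℕ → E} {a b : E} (hp : Tendsto p atTop (𝓝 a)) (hq : Tendsto q atTop (𝓝 b))
    (h : ∀ n, p n ∈ subdiff f (q n)) : a ∈ subdiff f b := by
  -- The subgradient inequality places a convergent sequence in the closed epigraph, so no limit of
  -- $f(q_n)$ is needed.
  have key : ∀ (y : E) (t : ℝ), f y ≤ t → f b ≤ ((t - inner ℝ a (y - b) : ℝ) : EReal) := by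
    intro y t hyt
    have hlim : Tendsto (fun n => (q n, t - inner ℝ (p n) (y - q n))) atTop
        (𝓝 (b, t - inner ℝ a (y - b))) :=
      hq.prodMk_nhds (tendsto_const_nhds.sub (hp.inner (tendsto_const_nhds.sub hq)))
    refine (isClosed_realEpigraph hlsc).mem_of_tendsto hlim (Eventually.of_forall fun n => ?_)
    obtain ⟨r, hr⟩ := exists_eq_coe_of_ne (h n).1 (h n).2.1
    have := (mem_subdiff_iff hr).1 (h n) y t hyt
    change f (q n) ≤ ((t - inner ℝ (p n) (y - q n) : ℝ) : EReal)
    rw [hr, EReal.coe_le_coe_iff]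
    linarith
  obtain ⟨y, hy⟩ := hf.1
  obtain ⟨s, hs⟩ := hf.exists_eq_coe hy
  obtain ⟨r, hr⟩ := hf.exists_eq_coe (x := b) ((key y s hs.le).trans_lt (EReal.coe_lt_top _))
  refine (mem_subdiff_iff hr).2 fun y t hyt => ?_
  have := key y t hyt
  rw [hr, EReal.coe_le_coe_iff] at this
  linarith

theorem lowerSemicontinuous_conj {f : E → EReal} (hf : ∀ x, ⊥ < f x) :
    LowerSemicontinuous (conj f) := by
  refine lowerSemicontinuous_iSup fun x => Continuous.lowerSemicontinuous ?_
  by_cases hx : f x = ⊤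
  · simp only [hx, EReal.sub_top]
    exact continuous_const
  · obtain ⟨r, hr⟩ := exists_eq_coe_of_ne hx (hf x).ne'
    simp only [hr, ← EReal.coe_sub]
    exact continuous_coe_real_ereal.comp (by fun_prop)

/-- Inversion of the subdifferential of a proper convex lower semicontinuous function. -/
theorem mem_subdiff_of_mem_subdiff_conj [CompleteSpace E] {f : E → EReal} (hf : IsProper f)
    (hconv : IsConvex f) (hlsc : LowerSemicontinuous f) {u w : E}
    (h : w ∈ subdiff (conj f) u) : u ∈ subdiff f w := by
  obtain ⟨s, hs⟩ := exists_eq_coe_of_ne h.1 h.2.1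
  have hs' := (conj_le_iff hf.2).1 hs.le
  have hle : f w ≤ ((inner ℝ u w - s : ℝ) : EReal) := by
    by_contra hlt
    obtain ⟨F, β, hF, hepi⟩ := geometric_hahn_banach_point_closed (x := (w, inner ℝ u w - s))
      hconv (isClosed_realEpigraph hlsc) hlt
    set v := (InnerProductSpace.toDual ℝ E).symm (F.comp (ContinuousLinearMap.inl ℝ E ℝ)) with hv
    set c := F (0, 1) with hc
    have hFv : ∀ y t, F (y, t) = inner ℝ v y + t * c := by
      intro y t
      have : ((y, t) : E × ℝ) = (y, 0) + t • (0, 1) := by ext <;> simp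
      rw [this, map_add, map_smul, smul_eq_mul, hv, InnerProductSpace.toDual_symm_apply]
      rfl
    have hepi' : ∀ (y : E) (t : ℝ), f y ≤ t → β < inner ℝ v y + t * c := fun y t hyt => by
      rw [← hFv]
      exact hepi (y, t) hyt
    rw [hFv] at hF
    have hc0 : 0 ≤ c := by
      by_contra! hneg
      obtain ⟨y, hy⟩ := hf.1
      obtain ⟨t, ht⟩ := hf.exists_eq_coe hy
      have h1 := hepi' y t ht.le
      set n := (inner ℝ v y + t * c - β) / (-c) with hn
      have hn0 : 0 ≤ n := div_nonneg (by linarith) (by linarith)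
      have h2 := hepi' y (t + n) (ht.le.trans (by exact_mod_cast (by linarith : t ≤ t + n)))
      have h3 : n * (-c) = inner ℝ v y + t * c - β := div_mul_cancel₀ _ (by linarith)
      linarith
    have hc1 : 0 < 1 + c := by linarith
    -- Adding $\langle u,y\rangle-t\le s$ to the separation inequality makes the coefficient of $t$
    -- equal to $1+c>0$, which also covers vertical hyperplanes ($c=0$).
    have hconj : conj f ((1 + c)⁻¹ • (u - v)) ≤ (((1 + c)⁻¹ * (s - β) : ℝ) : EReal) := by
      refine (conj_le_iff hf.2).2 fun y t hyt => ?_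
      have h1 := hs' y t hyt
      have h2 := hepi' y t hyt
      rw [real_inner_smul_left, inner_sub_left]
      have h3 : (inner ℝ u y - inner ℝ v y) - (1 + c) * t ≤ s - β := by linarith
      have h4 := mul_le_mul_of_nonneg_left h3 (inv_pos.2 hc1).le
      rwa [mul_sub, inv_mul_cancel_left₀ hc1.ne'] at h4
    have h5 := (mem_subdiff_iff hs).1 h _ _ hconj
    rw [inner_sub_right, real_inner_smul_right, inner_sub_right, real_inner_comm u w,
      real_inner_comm v w] at h5
    have h6 := mul_le_mul_of_nonneg_left h5 hc1.le
    rw [mul_inv_cancel_left₀ hc1.ne'] at h6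
    have h7 : (1 + c) * (s + ((1 + c)⁻¹ * (inner ℝ u w - inner ℝ v w) - inner ℝ u w)) =
        (1 + c) * s + (inner ℝ u w - inner ℝ v w) - (1 + c) * inner ℝ u w := by
      field_simp
      ring
    rw [h7] at h6
    linarith
  obtain ⟨r, hr⟩ := hf.exists_eq_coe (x := w) (hle.trans_lt (EReal.coe_lt_top _))
  rw [hr, EReal.coe_le_coe_iff] at hle
  refine (mem_subdiff_iff hr).2 fun y t hyt => ?_
  have := hs' y t hyt
  rw [inner_sub_right]
  linarith

end Subdifferential

/-! ### Proximal points of conjugates -/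

section Prox

variable {E : Type*} [NormedAddCommGroup E] [InnerProductSpace ℝ E]

/-- The conjugate has an affine minorant, so the quadratic term bounds a sublevel set and
compactness gives a minimizer. -/
theorem exists_isProxPoint_conj [FiniteDimensional ℝ E] {f : E → EReal} (hf : IsProper f)
    (hdom : (dom (conj f)).Nonempty) {σ : ℝ} (hσ : 0 < σ) (v : E) :
    ∃ p, IsProxPoint σ (conj f) v p := by
  obtain ⟨u₀, hu₀⟩ := hdom
  obtain ⟨r₀, hr₀⟩ := exists_eq_coe_of_ne (ne_of_lt hu₀) (bot_lt_conj hf u₀).ne'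
  obtain ⟨x₁, hx₁⟩ := hf.1
  obtain ⟨t₁, ht₁⟩ := hf.exists_eq_coe hx₁
  set h : E → EReal := fun y => conj f y + ((1 / (2 * σ) * ‖y - v‖ ^ 2 : ℝ) : EReal) with hh
  have hlsc : LowerSemicontinuous h := by
    refine (lowerSemicontinuous_conj hf.2).add'
      (continuous_coe_real_ereal.comp (by fun_prop :
        Continuous fun y : E => 1 / (2 * σ) * ‖y - v‖ ^ 2)).lowerSemicontinuous fun y => ?_
    exact EReal.continuousAt_add (Or.inr (EReal.coe_ne_bot _)) (Or.inr (EReal.coe_ne_top _))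
  set c₀ : ℝ := r₀ + 1 / (2 * σ) * ‖u₀ - v‖ ^ 2 with hc₀
  have hu₀c : h u₀ = c₀ := by
    simp only [hh, hr₀]
    norm_cast
  set D : ℝ := c₀ + t₁ - inner ℝ v x₁
  -- The summand $1$ gives $\|y-v\|\ge1$ outside the ball, so $|D|\le|D|\,\|y-v\|$ there.
  set ρ : ℝ := 2 * σ * (‖x₁‖ + |D|) + 1 with hρ
  have hbound : ∀ y, h y ≤ c₀ → ‖y - v‖ ≤ ρ := by
    intro y hy
    have h1 : (((inner ℝ y x₁ - t₁) + 1 / (2 * σ) * ‖y - v‖ ^ 2 : ℝ) : EReal) ≤ c₀ := by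
      refine le_trans ?_ hy
      rw [EReal.coe_add]
      exact add_le_add (inner_sub_le_conj ht₁.le y) le_rfl
    rw [EReal.coe_le_coe_iff] at h1
    have h2 : -(‖y - v‖ * ‖x₁‖) ≤ inner ℝ y x₁ - inner ℝ v x₁ := by
      rw [← inner_sub_left]
      exact neg_le_of_abs_le (abs_real_inner_le_norm _ _)
    have h3 : 1 / (2 * σ) * ‖y - v‖ ^ 2 ≤ ‖y - v‖ * ‖x₁‖ + |D| := by
      have := le_abs_self D
      simp only [D] at this ⊢
      linarith
    have h4 : ‖y - v‖ ^ 2 ≤ 2 * σ * (‖y - v‖ * ‖x₁‖ + |D|) := by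
      have := mul_le_mul_of_nonneg_left h3 (by positivity : 0 ≤ 2 * σ)
      rwa [← mul_assoc, mul_one_div_cancel (by positivity), one_mul] at this
    by_contra! hlt
    have hpos : 0 ≤ 2 * σ * (‖x₁‖ + |D|) := by positivity
    have hn1 : 1 ≤ ‖y - v‖ := by linarith
    have h5 : 2 * σ * |D| ≤ 2 * σ * |D| * ‖y - v‖ :=
      le_mul_of_one_le_right (by positivity) hn1
    nlinarith
  have hmem : u₀ ∈ Metric.closedBall v ρ := by
    rw [mem_closedBall_iff_norm]
    exact hbound u₀ hu₀c.le
  obtain ⟨p, -, hp⟩ := (hlsc.lowerSemicontinuousOn _).exists_isMinOn ⟨u₀, hmem⟩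
    (isCompact_closedBall v ρ)
  refine ⟨p, fun y _ => ?_⟩
  by_cases hy : h y ≤ c₀
  · exact hp (by rw [mem_closedBall_iff_norm]; exact hbound y hy)
  · exact (hp hmem).trans (hu₀c.le.trans (le_of_not_ge hy))

/-- A proximal point satisfies the resolvent inclusion of the subdifferential. -/
theorem IsProxPoint.mem_subdiff {f : E → EReal} (hf : IsProper f)
    (hdom : (dom (conj f)).Nonempty) {σ : ℝ} (hσ : 0 < σ) {v p : E}
    (hp : IsProxPoint σ (conj f) v p) : σ⁻¹ • (v - p) ∈ subdiff (conj f) p := by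
  have hmin : ∀ (y : E) (t : ℝ), conj f y ≤ t →
      conj f p + ((1 / (2 * σ) * ‖p - v‖ ^ 2 : ℝ) : EReal) ≤
        ((t + 1 / (2 * σ) * ‖y - v‖ ^ 2 : ℝ) : EReal) := by
    intro y t hyt
    refine (hp (mem_univ y)).trans ?_
    rw [EReal.coe_add]
    exact add_le_add hyt le_rfl
  obtain ⟨u₀, hu₀⟩ := hdom
  obtain ⟨r₀, hr₀⟩ := exists_eq_coe_of_ne (ne_of_lt hu₀) (bot_lt_conj hf u₀).ne'
  obtain ⟨s, hs⟩ : ∃ s : ℝ, conj f p = s := by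
    refine exists_eq_coe_of_ne (fun htop => ?_) (bot_lt_conj hf p).ne'
    have := hmin u₀ r₀ hr₀.le
    rw [htop, EReal.top_add_coe] at this
    exact (EReal.coe_lt_top _).not_ge this
  have hmin' : ∀ (y : E) (t : ℝ), conj f y ≤ t →
      s + 1 / (2 * σ) * ‖p - v‖ ^ 2 ≤ t + 1 / (2 * σ) * ‖y - v‖ ^ 2 := by
    intro y t hyt
    have := hmin y t hyt
    rw [hs] at this
    exact_mod_cast this
  refine (mem_subdiff_iff hs).2 fun y t hyt => ?_
  set A : ℝ := t - s - inner ℝ (σ⁻¹ • (v - p)) (y - p) with hA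
  set B : ℝ := 1 / (2 * σ) * ‖y - p‖ ^ 2 with hB
  have hB0 : 0 ≤ B := by positivity
  -- Compares $p$ with $p+\theta(y-p)$ and divides by $\theta$.
  have key : ∀ θ : ℝ, 0 < θ → θ ≤ 1 → 0 ≤ A + θ * B := by
    intro θ h0 h1
    have hcv : conj f (p + θ • (y - p)) ≤ (((1 - θ) * s + θ * t : ℝ) : EReal) := by
      refine (conj_le_iff hf.2).2 fun x r hxr => ?_
      have h2 := (conj_le_iff hf.2).1 hs.le x r hxr
      have h3 := (conj_le_iff hf.2).1 hyt x r hxr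
      rw [inner_add_left, real_inner_smul_left, inner_sub_left]
      nlinarith
    have h4 := hmin' _ _ hcv
    have h5 : ‖p + θ • (y - p) - v‖ ^ 2 =
        ‖p - v‖ ^ 2 - 2 * θ * inner ℝ (v - p) (y - p) + θ ^ 2 * ‖y - p‖ ^ 2 := by
      rw [show p + θ • (y - p) - v = (p - v) + θ • (y - p) by abel, norm_add_sq_real,
        real_inner_smul_right, norm_smul, mul_pow, Real.norm_eq_abs, sq_abs, ← neg_sub p v,
        inner_neg_left]
      ring
    rw [h5] at h4
    have h6 : 0 ≤ θ * (A + θ * B) := by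
      rw [hA, hB, real_inner_smul_left]
      have : 1 / (2 * σ) * (2 * θ * inner ℝ (v - p) (y - p)) =
          θ * (σ⁻¹ * inner ℝ (v - p) (y - p)) := by
        field_simp
      nlinarith
    exact nonneg_of_mul_nonneg_right h6 h0
  have hA0 : 0 ≤ A := by
    by_contra! hneg
    have hd : 0 < B - A := by linarith
    -- For $A<0$ this $\theta\in(0,1]$ makes $A+\theta B=-A^2/(B-A)<0$.
    have h1 := key (-A / (B - A)) (div_pos (by linarith) hd) ((div_le_one hd).2 (by linarith))
    have h2 : A + -A / (B - A) * B = -(A ^ 2 / (B - A)) := by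
      field_simp
      ring
    rw [h2] at h1
    have h3 : 0 < A ^ 2 / (B - A) := div_pos (sq_pos_of_neg hneg) hd
    linarith
  linarith

theorem prox_conj_mem_subdiff [FiniteDimensional ℝ E] {f : E → EReal} (hf : IsProper f)
    (hdom : (dom (conj f)).Nonempty) {σ : ℝ} (hσ : 0 < σ) (v : E) :
    σ⁻¹ • (v - prox σ (conj f) v) ∈ subdiff (conj f) (prox σ (conj f) v) :=
  IsProxPoint.mem_subdiff hf hdom hσ (Classical.epsilon_spec (exists_isProxPoint_conj hf hdom hσ v))

end Prox

/-! ### Fejér monotone sequences -/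

section Fejer

/-- A sequence that is Fejér monotone with respect to a set containing its cluster points
converges to a point of this set. -/
theorem exists_tendsto_of_fejer {E : Type*} [NormedAddCommGroup E] [ProperSpace E] {u : ℕ → E}
    {S : Set E} {Q : E → ℝ} (hS : S.Nonempty) (hQ : Continuous Q) (hQ0 : Q 0 = 0) {c : ℝ}
    (hc : 0 < c) (hQc : ∀ v, c * ‖v‖ ^ 2 ≤ Q v)
    (hdec : ∀ p ∈ S, ∀ n, Q (u (n + 1) - p) ≤ Q (u n - p))
    (hcluster : ∀ (v : E) (φ : ℕ → ℕ), StrictMono φ → Tendsto (fun n => u (φ n)) atTop (𝓝 v) →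
      v ∈ S) :
    ∃ v ∈ S, Tendsto u atTop (𝓝 v) := by
  have hnorm : ∀ v, ‖v‖ ≤ Real.sqrt (Q v / c) := fun v => by
    refine Real.le_sqrt_of_sq_le ?_
    rw [le_div_iff₀ hc, mul_comm]
    exact hQc v
  have hanti : ∀ p ∈ S, Antitone fun n => Q (u n - p) := fun p hp =>
    antitone_nat_of_succ_le (hdec p hp)
  obtain ⟨p, hp⟩ := hS
  have hbdd : ∀ n, u n ∈ Metric.closedBall p (Real.sqrt (Q (u 0 - p) / c)) := by
    intro n
    rw [mem_closedBall_iff_norm]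
    refine (hnorm _).trans (Real.sqrt_le_sqrt ?_)
    gcongr
    exact hanti p hp (Nat.zero_le n)
  obtain ⟨v, -, φ, hφ, hv⟩ := (isCompact_closedBall p _).tendsto_subseq hbdd
  have hvS := hcluster v φ hφ hv
  refine ⟨v, hvS, ?_⟩
  have hsub : Tendsto (fun n => Q (u (φ n) - v)) atTop (𝓝 0) := by
    have := (hQ.tendsto (v - v)).comp (hv.sub_const v)
    rwa [sub_self, hQ0] at this
  have hfull : Tendsto (fun n => Q (u n - v)) atTop (𝓝 0) := by
    have hlim := tendsto_atTop_ciInf (hanti v hvS)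
      ⟨0, by
        rintro _ ⟨n, rfl⟩
        exact (by positivity : 0 ≤ c * ‖u n - v‖ ^ 2).trans (hQc _)⟩
    rwa [tendsto_nhds_unique (hlim.comp hφ.tendsto_atTop) hsub] at hlim
  rw [tendsto_iff_norm_sub_tendsto_zero]
  refine squeeze_zero (fun n => norm_nonneg _) (fun n => hnorm _) ?_
  simpa using (hfull.div_const c).sqrt

theorem tendsto_zero_of_telescoping {a b : ℕ → ℝ} (ha : ∀ n, 0 ≤ a n) (hb : ∀ n, 0 ≤ b n)
    (h : ∀ n, a (n + 1) + b n ≤ a n) : Tendsto b atTop (𝓝 0) := by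
  have hanti : Antitone a := antitone_nat_of_succ_le fun n => by linarith [h n, hb n]
  have hlim := tendsto_atTop_ciInf hanti ⟨0, by rintro _ ⟨n, rfl⟩; exact ha n⟩
  refine squeeze_zero hb (fun n => (by linarith [h n] : b n ≤ a n - a (n + 1))) ?_
  simpa using hlim.sub (hlim.comp (tendsto_add_atTop_nat 1))

end Fejer

/-! ### The quadratic form of the iteration -/

section Metric

variable {k : ℕ} {X : Type*} [NormedAddCommGroup X] [InnerProductSpace ℝ X]
  {Y : Fin k → Type*} [∀ i, NormedAddCommGroup (Y i)] [∀ i, InnerProductSpace ℝ (Y i)]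

/-- The quadratic form that turns the primal-dual iteration into a proximal point iteration. -/
def primalDualForm (ω : Fin k → ℝ) (K : ∀ i, X →L[ℝ] Y i) (σ τ : ℝ) (v : X × ∀ i, Y i) : ℝ :=
  τ⁻¹ * ‖v.1‖ ^ 2 + ∑ i, ω i * (σ⁻¹ * ‖v.2 i‖ ^ 2 - 2 * inner ℝ (K i v.1) (v.2 i))

variable {ω : Fin k → ℝ} {K : ∀ i, X →L[ℝ] Y i} {σ τ : ℝ}

theorem continuous_primalDualForm : Continuous (primalDualForm ω K σ τ) := by
  unfold primalDualForm
  refine (continuous_const.mul (continuous_fst.norm.pow 2)).add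
    (continuous_finsetSum _ fun i _ => continuous_const.mul ?_)
  have hi : Continuous fun v : X × ∀ i, Y i => v.2 i := (continuous_apply i).comp continuous_snd
  exact (continuous_const.mul (hi.norm.pow 2)).sub
    (continuous_const.mul (((K i).continuous.comp continuous_fst).inner hi))

theorem primalDualForm_zero : primalDualForm ω K σ τ 0 = 0 := by
  simp [primalDualForm]

theorem primalDualForm_neg (v : X × ∀ i, Y i) :
    primalDualForm ω K σ τ (-v) = primalDualForm ω K σ τ v := by
  simp [primalDualForm]

theorem primalDualForm_add (v w : X × ∀ i, Y i) :
    primalDualForm ω K σ τ (v + w) = primalDualForm ω K σ τ v + primalDualForm ω K σ τ w +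
      2 * (τ⁻¹ * inner ℝ v.1 w.1 + ∑ i, ω i * (σ⁻¹ * inner ℝ (v.2 i) (w.2 i) -
        inner ℝ (K i v.1) (w.2 i) - inner ℝ (K i w.1) (v.2 i))) := by
  simp only [primalDualForm, Prod.fst_add, Prod.snd_add, Pi.add_apply, map_add, norm_add_sq_real,
    inner_add_left, inner_add_right]
  have : ∑ i, ω i * (σ⁻¹ * (‖v.2 i‖ ^ 2 + 2 * inner ℝ (v.2 i) (w.2 i) + ‖w.2 i‖ ^ 2) -
        2 * (inner ℝ (K i v.1) (v.2 i) + inner ℝ (K i w.1) (v.2 i) +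
          (inner ℝ (K i v.1) (w.2 i) + inner ℝ (K i w.1) (w.2 i)))) =
      ∑ i, ω i * (σ⁻¹ * ‖v.2 i‖ ^ 2 - 2 * inner ℝ (K i v.1) (v.2 i)) +
      ∑ i, ω i * (σ⁻¹ * ‖w.2 i‖ ^ 2 - 2 * inner ℝ (K i w.1) (w.2 i)) +
      2 * ∑ i, ω i * (σ⁻¹ * inner ℝ (v.2 i) (w.2 i) -
        inner ℝ (K i v.1) (w.2 i) - inner ℝ (K i w.1) (v.2 i)) := by
    rw [Finset.mul_sum, ← Finset.sum_add_distrib, ← Finset.sum_add_distrib]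
    exact Finset.sum_congr rfl fun i _ => by ring
  rw [this]
  ring

/-- Coercivity of the form under the step size condition. -/
theorem exists_le_primalDualForm (hω : ∀ i, 0 < ω i) (hω1 : ∀ i, ω i ≤ 1) (hσ : 0 < σ)
    (hτ : 0 < τ) (hστ : σ * τ * ∑ i, ‖K i‖ ^ 2 < 1) :
    ∃ c : ℝ, 0 < c ∧ ∀ v, c * ‖v‖ ^ 2 ≤ primalDualForm ω K σ τ v := by
  set N : ℝ := ∑ i, ‖K i‖ ^ 2 with hN
  have hN0 : 0 ≤ N := Finset.sum_nonneg fun i _ => by positivity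
  have hq0 : 0 ≤ σ * τ * N := by positivity
  -- The weight in Young's inequality must satisfy $\sigma<s$ and $sN<\tau^{-1}$; for $N>0$ this is
  -- the harmonic mean of $\sigma$ and $1/(\tau N)$.
  set s : ℝ := 2 * σ / (1 + σ * τ * N) with hs
  have hs0 : 0 < s := by positivity
  have hα : 0 < τ⁻¹ - s * N := by
    rw [sub_pos, hs, div_mul_eq_mul_div, div_lt_iff₀ (by positivity), lt_inv_mul_iff₀ hτ]
    nlinarith
  have hβ : 0 < σ⁻¹ - s⁻¹ := by
    rw [sub_pos, inv_lt_inv₀ hs0 hσ, hs, lt_div_iff₀ (by positivity)]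
    nlinarith
  set α := τ⁻¹ - s * N with hαdef
  set β := σ⁻¹ - s⁻¹ with hβdef
  have hlow : ∀ v : X × ∀ i, Y i,
      α * ‖v.1‖ ^ 2 + β * ∑ i, ω i * ‖v.2 i‖ ^ 2 ≤ primalDualForm ω K σ τ v := by
    intro v
    have hterm : ∀ i, β * (ω i * ‖v.2 i‖ ^ 2) - s * ‖v.1‖ ^ 2 * ‖K i‖ ^ 2 ≤
        ω i * (σ⁻¹ * ‖v.2 i‖ ^ 2 - 2 * inner ℝ (K i v.1) (v.2 i)) := by
      intro i
      have h1 : inner ℝ (K i v.1) (v.2 i) ≤ ‖K i‖ * ‖v.1‖ * ‖v.2 i‖ :=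
        (real_inner_le_norm _ _).trans
          (mul_le_mul_of_nonneg_right ((K i).le_opNorm _) (norm_nonneg _))
      have h2 : 2 * (‖K i‖ * ‖v.1‖ * ‖v.2 i‖) ≤
          s * (‖K i‖ * ‖v.1‖) ^ 2 + s⁻¹ * ‖v.2 i‖ ^ 2 := by
        have h3 : 0 ≤ s⁻¹ * (s * (‖K i‖ * ‖v.1‖) - ‖v.2 i‖) ^ 2 := by positivity
        have h4 : s⁻¹ * (s * (‖K i‖ * ‖v.1‖) - ‖v.2 i‖) ^ 2 =
            s * (‖K i‖ * ‖v.1‖) ^ 2 + s⁻¹ * ‖v.2 i‖ ^ 2 - 2 * (‖K i‖ * ‖v.1‖ * ‖v.2 i‖) := by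
          field_simp
          ring
        linarith
      have h5 : ω i * (s * (‖K i‖ * ‖v.1‖) ^ 2) ≤ s * (‖K i‖ * ‖v.1‖) ^ 2 :=
        mul_le_of_le_one_left (by positivity) (hω1 i)
      have h6 := mul_le_mul_of_nonneg_left (h2.trans' (mul_le_mul_of_nonneg_left h1 zero_le_two))
        (hω i).le
      rw [hβdef]
      nlinarith
    have hsum := Finset.sum_le_sum fun i (_ : i ∈ Finset.univ) => hterm i
    rw [Finset.sum_sub_distrib, ← Finset.mul_sum, ← Finset.mul_sum, ← hN] at hsum
    rw [primalDualForm, hαdef]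
    linarith
  obtain ⟨m, hm0, hm⟩ : ∃ m : ℝ, 0 < m ∧ ∀ i, m ≤ ω i := by
    -- As all weights are at most $1$, their product lies below each of them.
    refine ⟨∏ i, ω i, Finset.prod_pos fun i _ => hω i, fun i => ?_⟩
    rw [← Finset.mul_prod_erase _ _ (Finset.mem_univ i)]
    exact mul_le_of_le_one_right (hω i).le
      (Finset.prod_le_one (fun j _ => (hω j).le) fun j _ => hω1 j)
  have hcα : min α (β * m) ≤ α := min_le_left _ _
  have hcβ : min α (β * m) ≤ β * m := min_le_right _ _
  have hc : 0 < min α (β * m) := lt_min hα (by positivity)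
  refine ⟨min α (β * m), hc, fun v => (le_trans ?_ (hlow v))⟩
  set c := min α (β * m)
  have hsum0 : 0 ≤ ∑ i, ω i * ‖v.2 i‖ ^ 2 :=
    Finset.sum_nonneg fun i _ => mul_nonneg (hω i).le (by positivity)
  set G := α * ‖v.1‖ ^ 2 + β * ∑ i, ω i * ‖v.2 i‖ ^ 2 with hG
  have hG0 : 0 ≤ G := by positivity
  have h1 : ‖v.1‖ ≤ Real.sqrt (G / c) := by
    refine Real.le_sqrt_of_sq_le ?_
    rw [le_div_iff₀ hc]
    have := mul_le_mul_of_nonneg_right hcα (by positivity : 0 ≤ ‖v.1‖ ^ 2)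
    have : 0 ≤ β * ∑ i, ω i * ‖v.2 i‖ ^ 2 := by positivity
    linarith
  have h2 : ‖v.2‖ ≤ Real.sqrt (G / c) := by
    refine (pi_norm_le_iff_of_nonneg (Real.sqrt_nonneg _)).2 fun i => ?_
    refine Real.le_sqrt_of_sq_le ?_
    rw [le_div_iff₀ hc]
    have h3 : m * ‖v.2 i‖ ^ 2 ≤ ∑ i, ω i * ‖v.2 i‖ ^ 2 :=
      (mul_le_mul_of_nonneg_right (hm i) (by positivity)).trans
        (Finset.single_le_sum (f := fun i => ω i * ‖v.2 i‖ ^ 2)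
          (fun j _ => mul_nonneg (hω j).le (by positivity)) (Finset.mem_univ i))
    have h4 := mul_le_mul_of_nonneg_left h3 hβ.le
    have h5 := mul_le_mul_of_nonneg_right hcβ (by positivity : 0 ≤ ‖v.2 i‖ ^ 2)
    have : 0 ≤ α * ‖v.1‖ ^ 2 := by positivity
    linarith
  have h3 : ‖v‖ ^ 2 ≤ G / c := by
    have := pow_le_pow_left₀ (norm_nonneg v) (max_le h1 h2 : ‖v‖ ≤ _) 2
    rwa [Real.sq_sqrt (by positivity)] at this
  rwa [le_div_iff₀ hc, mul_comm] at h3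

end Metric

/-! ### Convergence of the primal-dual iteration -/

section Convergence

variable {k : ℕ} {X : Type*} [NormedAddCommGroup X] [InnerProductSpace ℝ X] [CompleteSpace X]
  {Y : Fin k → Type*} [∀ i, NormedAddCommGroup (Y i)] [∀ i, InnerProductSpace ℝ (Y i)]
  [∀ i, CompleteSpace (Y i)] {ω : Fin k → ℝ} {g : ∀ i, Y i → EReal} {K : ∀ i, X →L[ℝ] Y i}
  {σ τ : ℝ}

/-- One step of the iteration, viewed on pairs `(x, y)`, decreases the distance to every solution
in the metric of the quadratic form. -/
theorem primalDualForm_step_le (hω : ∀ i, 0 < ω i) (hσ : 0 < σ) (hτ : 0 < τ)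
    {f : ∀ i, Y i → EReal} {x x' xs : X} {y y' ys : ∀ i, Y i}
    (hx' : x' = x - τ • ∑ i, ω i • (ContinuousLinearMap.adjoint (K i)) (y i))
    (hy' : ∀ i, σ⁻¹ • (y i + σ • K i ((2 : ℝ) • x' - x) - y' i) ∈ subdiff (f i) (y' i))
    (hs : ∀ i, K i xs ∈ subdiff (f i) (ys i)) (hfeas : ys ∈ dualFeasible ω K) :
    primalDualForm ω K σ τ ((x', y') - (xs, ys)) + primalDualForm ω K σ τ ((x', y') - (x, y)) ≤
      primalDualForm ω K σ τ ((x, y) - (xs, ys)) := by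
  have e1 : ((x, y) - (xs, ys) : X × ∀ i, Y i) = ((x, y) - (x', y')) + ((x', y') - (xs, ys)) := by
    abel
  rw [e1, primalDualForm_add, ← neg_sub (x, y) (x', y'), primalDualForm_neg]
  have hx : τ⁻¹ * inner ℝ (x - x') (x' - xs) =
      ∑ i, ω i * inner ℝ (y i - ys i) (K i (x' - xs)) := by
    have h1 : x - x' = τ • ∑ i, ω i • (ContinuousLinearMap.adjoint (K i)) (y i) := by
      rw [hx']
      abel
    rw [h1, real_inner_smul_left, inv_mul_cancel_left₀ hτ.ne', inner_sum_adjoint]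
    simp only [inner_sub_left, mul_sub, Finset.sum_sub_distrib]
    rw [sum_inner_eq_zero hfeas, sub_zero]
  have hpos : 0 ≤ τ⁻¹ * inner ℝ (x - x') (x' - xs) +
      ∑ i, ω i * (σ⁻¹ * inner ℝ (y i - y' i) (y' i - ys i) -
        inner ℝ (K i (x - x')) (y' i - ys i) - inner ℝ (K i (x' - xs)) (y i - y' i)) := by
    rw [hx, ← Finset.sum_add_distrib]
    refine Finset.sum_nonneg fun i _ => ?_
    rw [← mul_add]
    refine mul_nonneg (hω i).le ?_
    have hmono := inner_sub_nonneg_of_mem_subdiff (hy' i) (hs i)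
    -- The extrapolation gives $2x'-x-x_s=(x'-x_s)-(x-x')$, producing exactly the coupling terms of
    -- the polarized form.
    have e2 : σ⁻¹ • (y i + σ • K i ((2 : ℝ) • x' - x) - y' i) - K i xs =
        σ⁻¹ • (y i - y' i) - K i (x - x') + K i (x' - xs) := by
      rw [add_sub_right_comm, smul_add, inv_smul_smul₀ hσ.ne']
      simp only [map_sub, map_smul]
      module
    rw [e2, inner_add_left, inner_sub_left, real_inner_smul_left] at hmono
    have e3 : inner ℝ (y i - ys i) (K i (x' - xs)) =
        inner ℝ (K i (x' - xs)) (y' i - ys i) + inner ℝ (K i (x' - xs)) (y i - y' i) := by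
      rw [← inner_add_right, real_inner_comm]
      congr 1
      abel
    rw [e3]
    linarith
  simp only [Prod.fst_sub, Prod.snd_sub, Pi.sub_apply]
  linarith

theorem iter_y_succ (x0 : X) (y0 : ∀ i, Y i) (n : ℕ) (i : Fin k) :
    (iter ω g K σ τ x0 y0 (n + 2)).y i = prox σ (conj (g i))
      ((iter ω g K σ τ x0 y0 (n + 1)).y i + σ • K i ((2 : ℝ) • (iter ω g K σ τ x0 y0 (n + 1)).x -
        (iter ω g K σ τ x0 y0 n).x)) :=
  rfl

/-- Convergence of the primal-dual iteration to a Kuhn–Tucker pair. -/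
theorem exists_tendsto_iter [FiniteDimensional ℝ X] [∀ i, FiniteDimensional ℝ (Y i)]
    (hω : ∀ i, 0 < ω i) (hω1 : ∀ i, ω i ≤ 1) (hg : ∀ i, IsProper (g i))
    (hconv : ∀ i, IsConvex (g i)) (hlsc : ∀ i, LowerSemicontinuous (g i))
    {xs : X} {ys : ∀ i, Y i} (hs : IsKuhnTucker ω g K xs ys) (hσ : 0 < σ) (hτ : 0 < τ)
    (hστ : σ * τ * ∑ i, ‖K i‖ ^ 2 < 1) (x0 : X) (y0 : ∀ i, Y i) :
    ∃ x y, IsKuhnTucker ω g K x y ∧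
      Tendsto (fun n => (iter ω g K σ τ x0 y0 n).x) atTop (𝓝 x) ∧
      Tendsto (fun n => (iter ω g K σ τ x0 y0 n).y) atTop (𝓝 y) := by
  let S : Set (X × ∀ i, Y i) :=
    {v | (∀ i, K i v.1 ∈ subdiff (conj (g i)) (v.2 i)) ∧ v.2 ∈ dualFeasible ω K}
  have hsS : (xs, ys) ∈ S :=
    ⟨fun i => mem_subdiff_conj_of_mem_subdiff (hg i) (hs.mem_subdiff i), hs.feasible⟩
  have hdom : ∀ i, (dom (conj (g i))).Nonempty := fun i => ⟨ys i, lt_top_iff_ne_top.2 (hsS.1 i).1⟩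
  have hproper : ∀ i, IsProper (conj (g i)) := fun i => ⟨hdom i, bot_lt_conj (hg i)⟩
  -- Pairing $x^n$ with $y^{n+1}$ makes the recursion autonomous; the convention $\bar x^0=x^0$
  -- affects only $u^0$.
  set u : ℕ → X × ∀ i, Y i :=
    fun n => ((iter ω g K σ τ x0 y0 n).x, (iter ω g K σ τ x0 y0 (n + 1)).y) with hu
  have hux : ∀ n, (u (n + 1)).1 = (u n).1 -
      τ • ∑ i, ω i • (ContinuousLinearMap.adjoint (K i)) ((u n).2 i) := fun n => rfl
  have huy : ∀ n i, σ⁻¹ • ((u n).2 i + σ • K i ((2 : ℝ) • (u (n + 1)).1 - (u n).1) -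
      (u (n + 1)).2 i) ∈ subdiff (conj (g i)) ((u (n + 1)).2 i) := by
    intro n i
    simp only [hu]
    rw [iter_y_succ]
    exact prox_conj_mem_subdiff (hg i) (hdom i) hσ _
  obtain ⟨c, hc, hQc⟩ := exists_le_primalDualForm (K := K) hω hω1 hσ hτ hστ
  set Q := primalDualForm ω K σ τ with hQ
  have hQ0 : ∀ v, 0 ≤ Q v := fun v => (by positivity : 0 ≤ c * ‖v‖ ^ 2).trans (hQc v)
  have hstep : ∀ p ∈ S, ∀ n, Q (u (n + 1) - p) + Q (u (n + 1) - u n) ≤ Q (u n - p) :=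
    fun p hp n => primalDualForm_step_le hω hσ hτ (hux n) (huy n) hp.1 hp.2
  have hreg : Tendsto (fun n => u (n + 1) - u n) atTop (𝓝 0) := by
    have h1 := tendsto_zero_of_telescoping (fun n => hQ0 (u n - (xs, ys)))
      (fun n => hQ0 (u (n + 1) - u n)) (hstep _ hsS)
    have h2 : Tendsto (fun n => ‖u (n + 1) - u n‖ ^ 2) atTop (𝓝 0) := by
      refine squeeze_zero (fun n => by positivity) (fun n => ?_) (by simpa using h1.div_const c)
      rw [le_div_iff₀ hc, mul_comm]
      exact hQc _
    rw [tendsto_zero_iff_norm_tendsto_zero]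
    simpa using h2.sqrt
  obtain ⟨⟨x, y⟩, hv, hlim⟩ := exists_tendsto_of_fejer ⟨_, hsS⟩ continuous_primalDualForm
    primalDualForm_zero hc hQc
    (fun p hp n => (by linarith [hstep p hp n, hQ0 (u (n + 1) - u n)] :
      Q (u (n + 1) - p) ≤ Q (u n - p)))
    (by
      rintro ⟨x, y⟩ φ hφ hlim
      have hdiff := hreg.comp hφ.tendsto_atTop
      have hlim' : Tendsto (fun n => u (φ n + 1)) atTop (𝓝 (x, y)) := by
        simpa using hdiff.add hlim
      have hx := (continuous_fst.tendsto _).comp hlim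
      have hx' := (continuous_fst.tendsto _).comp hlim'
      have hy : ∀ i, Tendsto (fun n => (u (φ n)).2 i) atTop (𝓝 (y i)) := fun i =>
        (((continuous_apply i).comp continuous_snd).tendsto (x, y)).comp hlim
      have hy' : ∀ i, Tendsto (fun n => (u (φ n + 1)).2 i) atTop (𝓝 (y i)) := fun i =>
        (((continuous_apply i).comp continuous_snd).tendsto (x, y)).comp hlim'
      refine ⟨fun i => ?_, ?_⟩
      · refine mem_subdiff_of_tendsto (hproper i) (lowerSemicontinuous_conj (hg i).2) ?_ (hy' i)
          fun n => huy (φ n) i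
        have h3 := (((hy i).add ((((K i).continuous.tendsto _).comp
          ((hx'.const_smul (2 : ℝ)).sub hx)).const_smul σ)).sub (hy' i)).const_smul σ⁻¹
        rw [add_sub_cancel_left, inv_smul_smul₀ hσ.ne', two_smul, add_sub_cancel_right] at h3
        exact h3
      -- The sum equals $\tau^{-1}(x^{\varphi(n)}-x^{\varphi(n)+1})$, which tends to zero.
      · have h4 : Tendsto (fun n => ∑ i, ω i •
            (ContinuousLinearMap.adjoint (K i)) ((u (φ n)).2 i)) atTop
            (𝓝 (∑ i, ω i • (ContinuousLinearMap.adjoint (K i)) (y i))) :=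
          tendsto_finsetSum _ fun i _ =>
            (((ContinuousLinearMap.adjoint (K i)).continuous.tendsto _).comp (hy i)).const_smul _
        have h5 : Tendsto (fun n => ∑ i, ω i •
            (ContinuousLinearMap.adjoint (K i)) ((u (φ n)).2 i)) atTop (𝓝 0) := by
          have h6 := (hx.sub hx').const_smul τ⁻¹
          rw [sub_self, smul_zero] at h6
          refine h6.congr fun n => ?_
          simp only [Function.comp_apply, hux]
          rw [sub_sub_cancel, inv_smul_smul₀ hτ.ne']
        exact tendsto_nhds_unique h4 h5)
  refine ⟨x, y, ⟨fun i => mem_subdiff_of_mem_subdiff_conj (hg i) (hconv i) (hlsc i) (hv.1 i),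
    hv.2⟩, (continuous_fst.tendsto _).comp hlim, ?_⟩
  exact (tendsto_add_atTop_iff_nat 1).1 ((continuous_snd.tendsto _).comp hlim)

end Convergence

end PrimalDual

end

/-! ### Main theorem -/

theorem theorem18 {k : ℕ}
    {X : Type*} [NormedAddCommGroup X] [InnerProductSpace ℝ X] [CompleteSpace X]
    {Y : Fin k → Type*} [∀ i, NormedAddCommGroup (Y i)] [∀ i, InnerProductSpace ℝ (Y i)]
    [∀ i, CompleteSpace (Y i)]
    (ω : Fin k → ℝ) (hω : ∀ i, 0 < ω i ∧ ω i ≤ 1) (hωsum : ∑ i, ω i = 1)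
    (g : ∀ i, Y i → EReal) (hproper : ∀ i, PrimalDual.IsProper (g i))
    (hconvex : ∀ i, PrimalDual.IsConvex (g i)) (hlsc : ∀ i, LowerSemicontinuous (g i))
    (K : ∀ i, X →L[ℝ] Y i)
    (xhat : X) (hxhat : PrimalDual.IsPrimalOptimal ω g K xhat)
    (hQC : PrimalDual.QC1 g K ∨ PrimalDual.QC2 g K ∨ PrimalDual.QC3 g K) :
    (∃ yhat : ∀ i, Y i,
      PrimalDual.IsDualOptimal ω g K yhat ∧
      PrimalDual.primalValue ω g K = PrimalDual.dualValue ω g K ∧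
      (∀ i, K i xhat ∈ PrimalDual.subdiff (PrimalDual.conj (g i)) (yhat i)) ∧
      ∑ i, ω i • (ContinuousLinearMap.adjoint (K i)) (yhat i) = 0) ∧
    (FiniteDimensional ℝ X → (∀ i, FiniteDimensional ℝ (Y i)) →
      ∀ σ τ : ℝ, 0 < σ → 0 < τ → σ * τ * ∑ i, ‖K i‖ ^ 2 < 1 →
      ∀ (x0 : X) (y0 : ∀ i, Y i),
        (∃ xstar : X, PrimalDual.IsPrimalOptimal ω g K xstar ∧
          Tendsto (fun n => (PrimalDual.iter ω g K σ τ x0 y0 n).x) atTop (𝓝 xstar)) ∧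
        (∃ ystar : ∀ i, Y i, PrimalDual.IsDualOptimal ω g K ystar ∧
          Tendsto (fun n => (PrimalDual.iter ω g K σ τ x0 y0 n).y) atTop (𝓝 ystar))) := by
  have hω0 : ∀ i, 0 < ω i := fun i => (hω i).1
  have hQC3 : PrimalDual.QC3 g K := by
    rcases hQC with h | h | h
    · exact h.qc2.qc3
    · exact h.qc3
    · exact h
  obtain ⟨yhat, hy⟩ := hQC3.exists_isKuhnTucker hω0 hωsum hproper hconvex hlsc hxhat
  refine ⟨⟨yhat, hy.isDualOptimal hω0 hproper, hy.primalValue_eq hω0 hproper,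
    fun i => PrimalDual.mem_subdiff_conj_of_mem_subdiff (hproper i) (hy.mem_subdiff i),
    hy.feasible⟩, ?_⟩
  intro hX hY σ τ hσ hτ hστ x0 y0
  -- The certificate from part (i) supplies the nonempty solution set that the Fejér argument needs.
  obtain ⟨x, y, hxy, hxlim, hylim⟩ := PrimalDual.exists_tendsto_iter hω0 (fun i => (hω i).2)
    hproper hconvex hlsc hy hσ hτ hστ x0 y0
  exact ⟨⟨x, hxy.isPrimalOptimal hω0 hproper, hxlim⟩, ⟨y, hxy.isDualOptimal hω0 hproper, hylim⟩⟩
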